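/- Consider real solutions of the first Painlevé equation $$y''(x)=6\,y(x)^2-x ,$$ each one defined on its interval of existence, i.e. the largest connected open subset of $\mathbb{R}$ on which the solution has no poles (the maximal open interval to which it extends as a real solution). Two solutions are regarded as different if their intervals of existence are different or if they take different values somewhere on a common interval of existence. The graphs of two solutions are said to intersect at the point at infinity with abscissa $p\in\mathbb{R}$ if $p$ is a common pole of them, i.e. if $p$ is a common (finite) end point of their intervals of existence. **Theorem.** The graphs of any two different real solutions have at most two points of intersection with non-positive abscissas, where finite points of intersection and points of intersection at infinity are both counted. -/

import Mathlib

namespace PainleveI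

/-- The real function `y` solves the first Painlevé equation `y'' = 6 y ^ 2 - x` at every point of
`I`. It is only used for open sets `I`, so that the derivatives at the points of `I` do not depend
on the values of `y` outside `I`. -/
def SolvesOn (I : Set ℝ) (y : ℝ → ℝ) : Prop :=
  ∀ x ∈ I, DifferentiableAt ℝ y x ∧ HasDerivAt (deriv y) (6 * y x ^ 2 - x) x

/-- `y` is a real solution of the first Painlevé equation with interval of existence `I`:
`I` is a nonempty open interval (possibly unbounded), `y` solves the equation on `I`, and `y` cannot
be continued as a real solution to a larger open interval. The values of `y` outside `I` play no
role. -/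
structure IsSolution (I : Set ℝ) (y : ℝ → ℝ) : Prop where
  isOpen : IsOpen I
  isConnected : IsConnected I
  solves : SolvesOn I y
  maximal : ∀ (J : Set ℝ) (z : ℝ → ℝ), IsOpen J → IsConnected J → I ⊆ J →
    SolvesOn J z → Set.EqOn z y I → J = I

/-- `p` is a (finite) end point of the nonempty interval `I`. For the interval of existence of a
solution, the finite end points are its poles. -/
def IsEndPoint (I : Set ℝ) (p : ℝ) : Prop :=
  IsGLB I p ∨ IsLUB I p

/-- The graph of the solution `y` with interval of existence `I`, completed by one point at
infinity `(p, ∞)` over every finite end point `p` of `I`. -/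
def extendedGraph (I : Set ℝ) (y : ℝ → ℝ) : Set (ℝ × OnePoint ℝ) :=
  {P | P.1 ∈ I ∧ P.2 = ((y P.1 : ℝ) : OnePoint ℝ)} ∪
    {P | IsEndPoint I P.1 ∧ P.2 = OnePoint.infty}

/-- The common points, finite or at infinity, of the graphs of two solutions. -/
def intersectionPoints (I₁ : Set ℝ) (y₁ : ℝ → ℝ) (I₂ : Set ℝ) (y₂ : ℝ → ℝ) :
    Set (ℝ × OnePoint ℝ) :=
  extendedGraph I₁ y₁ ∩ extendedGraph I₂ y₂

end PainleveI

/-!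
Let `w = y₁ - y₂` and `u = y₁ + y₂`, so that `w'' = 6 u w` and `u'' = 3 u ^ 2 + 3 w ^ 2 - 2 x`. On
the half-line `x < 0` the function `u` is a strict supersolution of `U'' = 3 U ^ 2`, and `w` solves
`w'' = 6 u w`, whose counterpart `v'' = 6 U v` is the linearization of `U'' = 3 U ^ 2`. If `w`
vanishes at `β < 0` and `u' β ≥ 0`, let `U` be the solution that turns at the value `u β`. A Sturm
comparison of `w` with `U'`, taken at points where `U` and `u` have the same value, shows that `w'`
keeps its sign to the right of `β` up to `0`. If `u' β ≤ 0`, the same argument after the reflection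
`x ↦ -x`, which makes the equation `y'' = 6 y ^ 2 + x`, applies to the left of `β`. In
either case `|w|` increases strictly on that side and cannot tend to `0` there. At a common pole `b`
both solutions are `(b - x)⁻² + o(1)`, so `w` tends to `0` at every intersection point, finite or
not. Hence no intersection point lies strictly between two others with non-positive abscissas.
-/

namespace PainleveI

open Set Filter Topology Asymptotics

section Order

theorem encard_le_two_of_forall_not_lt {α : Type*} [LinearOrder α] {s : Set α}
    (h : ∀ x ∈ s, ∀ y ∈ s, ∀ z ∈ s, x < y → ¬ y < z) : s.encard ≤ 2 := by
  by_contra! hcard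
  obtain ⟨t, hts, ht⟩ := exists_subset_encard_eq (Order.add_one_le_of_lt hcard : (3 : ℕ∞) ≤ _)
  lift t to Finset α using finite_of_encard_eq_coe ht
  have ht3 : t.card = 3 := by exact_mod_cast (encard_coe_eq_coe_finsetCard t).symm.trans ht
  have hmem : ∀ i, t.orderEmbOfFin ht3 i ∈ s := fun i => hts (t.orderEmbOfFin_mem ht3 i)
  exact h _ (hmem 0) _ (hmem 1) _ (hmem 2) (by simp) (by simp)

theorem Ioo_subset_of_mem_closure {α : Type*} [LinearOrder α] [TopologicalSpace α]
    [OrderClosedTopology α] {I : Set α} {a b : α} (hI : I.OrdConnected) (ha : a ∈ closure I)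
    (hb : b ∈ closure I) : Ioo a b ⊆ I := by
  intro x hx
  obtain ⟨s, hsx, hs⟩ := mem_closure_iff.1 ha _ isOpen_Iio hx.1
  obtain ⟨t, hxt, ht⟩ := mem_closure_iff.1 hb _ isOpen_Ioi hx.2
  exact hI.out hs ht ⟨hsx.le, hxt.le⟩

end Order

section Monotone

variable {a b : ℝ} {f f' : ℝ → ℝ}

theorem strictMonoOn_Icc_of_hasDerivAt (hc : ContinuousOn f (Icc a b))
    (hf : ∀ x ∈ Ioo a b, HasDerivAt f (f' x) x) (hpos : ∀ x ∈ Ioo a b, 0 < f' x) :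
    StrictMonoOn f (Icc a b) :=
  strictMonoOn_of_hasDerivWithinAt_pos (convex_Icc a b) hc
    (by simpa only [interior_Icc] using fun x hx => (hf x hx).hasDerivWithinAt)
    (by simpa only [interior_Icc] using hpos)

theorem continuousOn_of_hasDerivAt {s : Set ℝ} (hf : ∀ x ∈ s, HasDerivAt f (f' x) x) :
    ContinuousOn f s :=
  fun x hx => (hf x hx).continuousAt.continuousWithinAt

theorem forall_pos_of_forall_Ico_pos (hc : ContinuousOn f (Ico a b)) (ha : 0 < f a)
    (hstep : ∀ c ∈ Ioo a b, (∀ x ∈ Ico a c, 0 < f x) → 0 < f c) : ∀ x ∈ Ico a b, 0 < f x := by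
  intro x hx
  by_contra! hfx
  have hcx : ContinuousOn f (Icc a x) := hc.mono (Icc_subset_Ico_right hx.2)
  obtain ⟨c, ⟨hcI, hfc⟩, hleast⟩ :=
    (isCompact_Icc.of_isClosed_subset (hcx.preimage_isClosed_of_isClosed isClosed_Icc isClosed_Iic)
      inter_subset_left).exists_isLeast ⟨x, right_mem_Icc.2 hx.1, mem_Iic.2 hfx⟩
  have hac : a < c := hcI.1.lt_of_ne fun h => ha.not_ge (h ▸ hfc)
  refine (hstep c ⟨hac, hcI.2.trans_lt hx.2⟩ fun t ht => ?_).not_ge hfc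
  by_contra! hft
  exact ht.2.not_ge (hleast ⟨⟨ht.1, ht.2.le.trans hcI.2⟩, hft⟩)

end Monotone

section Comparison

variable {a b : ℝ} {u u' u'' w w' : ℝ → ℝ}

theorem strictMonoOn_deriv_of_three_mul_sq_lt (hu' : ∀ x ∈ Icc a b, HasDerivAt u' (u'' x) x)
    (hu'' : ∀ x ∈ Ioo a b, 3 * u x ^ 2 < u'' x) : StrictMonoOn u' (Icc a b) :=
  strictMonoOn_Icc_of_hasDerivAt (continuousOn_of_hasDerivAt hu')
    (fun x hx => hu' x (Ioo_subset_Icc_self hx))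
    fun x hx => lt_of_le_of_lt (by positivity) (hu'' x hx)

theorem deriv_pos_of_three_mul_sq_lt (hu' : ∀ x ∈ Icc a b, HasDerivAt u' (u'' x) x)
    (hu'' : ∀ x ∈ Ioo a b, 3 * u x ^ 2 < u'' x) (ha : 0 ≤ u' a) : ∀ x ∈ Ioc a b, 0 < u' x :=
  fun _ hx => ha.trans_lt <| strictMonoOn_deriv_of_three_mul_sq_lt hu' hu''
    (left_mem_Icc.2 (hx.1.le.trans hx.2)) (Ioc_subset_Icc_self hx) hx.1

theorem strictMonoOn_of_three_mul_sq_lt (hu : ∀ x ∈ Icc a b, HasDerivAt u (u' x) x)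
    (hu' : ∀ x ∈ Icc a b, HasDerivAt u' (u'' x) x)
    (hu'' : ∀ x ∈ Ioo a b, 3 * u x ^ 2 < u'' x) (ha : 0 ≤ u' a) : StrictMonoOn u (Icc a b) :=
  strictMonoOn_Icc_of_hasDerivAt (continuousOn_of_hasDerivAt hu)
    (fun x hx => hu x (Ioo_subset_Icc_self hx))
    fun x hx => deriv_pos_of_three_mul_sq_lt hu' hu'' ha x (Ioo_subset_Ioc_self hx)

-- The solution of `U'' = 3 U ^ 2` that turns at the value `u a` has `U' ^ 2 = 2 (U ^ 3 - u a ^ 3)`.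
theorem sqrt_two_mul_cube_sub_cube_lt_deriv (hu : ∀ x ∈ Icc a b, HasDerivAt u (u' x) x)
    (hu' : ∀ x ∈ Icc a b, HasDerivAt u' (u'' x) x)
    (hu'' : ∀ x ∈ Ioo a b, 3 * u x ^ 2 < u'' x) (ha : 0 ≤ u' a) {x : ℝ} (hx : x ∈ Ioc a b) :
    √(2 * (u x ^ 3 - u a ^ 3)) < u' x := by
  have hpos := deriv_pos_of_three_mul_sq_lt hu' hu'' ha
  have hderiv : ∀ t ∈ Icc a b, HasDerivAt (fun t => u' t ^ 2 - 2 * (u t ^ 3 - u a ^ 3))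
      (2 * u' t * (u'' t - 3 * u t ^ 2)) t := fun t ht =>
    (((hu' t ht).pow 2).sub ((((hu t ht).pow 3).sub_const _).const_mul 2)).congr_deriv
      (by push_cast; ring)
  have hmono := strictMonoOn_Icc_of_hasDerivAt (continuousOn_of_hasDerivAt hderiv)
    (fun t ht => hderiv t (Ioo_subset_Icc_self ht)) fun t ht =>
      mul_pos (mul_pos two_pos (hpos t (Ioo_subset_Ioc_self ht))) (sub_pos.2 (hu'' t ht))
  have hlt := hmono (left_mem_Icc.2 (hx.1.le.trans hx.2)) (Ioc_subset_Icc_self hx) hx.1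
  simp only [sub_self, mul_zero, sub_zero] at hlt
  rw [Real.sqrt_lt' (hpos x hx)]
  linarith [sq_nonneg (u' a)]

theorem hasDerivAt_mul_sqrt_sub_three_mul_sq_mul {x C : ℝ} (hu : HasDerivAt u (u' x) x)
    (hw : HasDerivAt w (w' x) x) (hw' : HasDerivAt w' (6 * u x * w x) x)
    (hC : 0 < 2 * (u x ^ 3 - C)) :
    HasDerivAt (fun t => w' t * √(2 * (u t ^ 3 - C)) - 3 * u t ^ 2 * w t)
      ((u' x - √(2 * (u x ^ 3 - C))) *
        (3 * u x ^ 2 * w' x / √(2 * (u x ^ 3 - C)) - 6 * u x * w x)) x := by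
  have : 0 < √(2 * (u x ^ 3 - C)) := Real.sqrt_pos.2 hC
  refine ((hw'.mul ((((hu.pow 3).sub_const C).const_mul 2).sqrt hC.ne')).sub
    (((hu.pow 2).const_mul 3).mul hw)).congr_deriv ?_
  simp only [Pi.pow_apply]
  field_simp
  push_cast
  ring

-- Let `U` solve `U'' = 3 U ^ 2` and turn at the value `u a`. Then `U'` solves the linearization
-- `v'' = 6 U v`, and `w' √(2 (u ^ 3 - u a ^ 3)) - 3 u ^ 2 w` is the Wronskian of `w` and `U'`, that
-- is `w' U' - w U''`, taken where `U = u`. It increases because `u` climbs faster than `U`.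
theorem three_mul_sq_mul_lt_deriv_mul_sqrt (hab : a < b)
    (hu : ∀ x ∈ Icc a b, HasDerivAt u (u' x) x) (hu' : ∀ x ∈ Icc a b, HasDerivAt u' (u'' x) x)
    (hu'' : ∀ x ∈ Ioo a b, 3 * u x ^ 2 < u'' x) (ha : 0 ≤ u' a) (hub : u b ≤ 0)
    (hw : ∀ x ∈ Icc a b, HasDerivAt w (w' x) x)
    (hw' : ∀ x ∈ Icc a b, HasDerivAt w' (6 * u x * w x) x) (hwa : w a = 0)
    (hpos : ∀ x ∈ Ioo a b, 0 < w x ∧ 0 < w' x) :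
    3 * u b ^ 2 * w b < w' b * √(2 * (u b ^ 3 - u a ^ 3)) := by
  have hmono := strictMonoOn_of_three_mul_sq_lt hu hu' hu'' ha
  have hT : ∀ x ∈ Ioo a b, 0 < 2 * (u x ^ 3 - u a ^ 3) := fun x hx =>
    mul_pos two_pos <| sub_pos.2 <| Odd.strictMono_pow (by decide) <|
      hmono (left_mem_Icc.2 hab.le) (Ioo_subset_Icc_self hx) hx.1
  have hc : ContinuousOn (fun t => w' t * √(2 * (u t ^ 3 - u a ^ 3)) - 3 * u t ^ 2 * w t)
      (Icc a b) := by
    have := continuousOn_of_hasDerivAt hu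
    have := continuousOn_of_hasDerivAt hw
    have := continuousOn_of_hasDerivAt hw'
    fun_prop
  have hwronskian := strictMonoOn_Icc_of_hasDerivAt hc
    (fun x hx => have hxI := Ioo_subset_Icc_self hx
      hasDerivAt_mul_sqrt_sub_three_mul_sq_mul (hu x hxI) (hw x hxI) (hw' x hxI) (hT x hx))
    (fun x hx => by
      have hux : u x < 0 :=
        (hmono (Ioo_subset_Icc_self hx) (right_mem_Icc.2 hab.le) hx.2).trans_le hub
      have hux2 : 0 < u x ^ 2 := sq_pos_of_neg hux
      have hS : 0 < √(2 * (u x ^ 3 - u a ^ 3)) := Real.sqrt_pos.2 (hT x hx)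
      have hSu : √(2 * (u x ^ 3 - u a ^ 3)) < u' x :=
        sqrt_two_mul_cube_sub_cube_lt_deriv hu hu' hu'' ha (Ioo_subset_Ioc_self hx)
      obtain ⟨hwx, hwx'⟩ := hpos x hx
      have hneg : 6 * u x * w x < 0 := mul_neg_of_neg_of_pos (by linarith) hwx
      have hquot : 0 < 3 * u x ^ 2 * w' x / √(2 * (u x ^ 3 - u a ^ 3)) := by positivity
      exact mul_pos (sub_pos.2 hSu) (sub_pos.2 (hneg.trans hquot)))
    (left_mem_Icc.2 hab.le) (right_mem_Icc.2 hab.le) hab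
  simpa [hwa] using hwronskian

theorem deriv_pos_of_three_mul_sq_lt_of_deriv_pos (hab : a < b)
    (hu : ∀ x ∈ Icc a b, HasDerivAt u (u' x) x) (hu' : ∀ x ∈ Icc a b, HasDerivAt u' (u'' x) x)
    (hu'' : ∀ x ∈ Ioo a b, 3 * u x ^ 2 < u'' x) (ha : 0 ≤ u' a)
    (hw : ∀ x ∈ Icc a b, HasDerivAt w (w' x) x)
    (hw' : ∀ x ∈ Icc a b, HasDerivAt w' (6 * u x * w x) x) (hwa : w a = 0)
    (hpos : ∀ x ∈ Ico a b, 0 < w' x) : 0 < w' b := by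
  have hwmono : StrictMonoOn w (Icc a b) :=
    strictMonoOn_Icc_of_hasDerivAt (continuousOn_of_hasDerivAt hw)
      (fun x hx => hw x (Ioo_subset_Icc_self hx)) fun x hx => hpos x (Ioo_subset_Ico_self hx)
  have hwpos : ∀ x ∈ Ioc a b, 0 < w x := fun x hx =>
    hwa ▸ hwmono (left_mem_Icc.2 hab.le) (Ioc_subset_Icc_self hx) hx.1
  rcases le_or_gt (u b) 0 with hub | hub
  · have hlt := three_mul_sq_mul_lt_deriv_mul_sqrt hab hu hu' hu'' ha hub hw hw' hwa fun x hx =>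
      ⟨hwpos x (Ioo_subset_Ioc_self hx), hpos x (Ioo_subset_Ico_self hx)⟩
    have hwb := hwpos b (right_mem_Ioc.2 hab)
    exact pos_of_mul_pos_left (lt_of_le_of_lt (by positivity) hlt) (Real.sqrt_nonneg _)
  · obtain ⟨c, hc, hupos⟩ : ∃ c ∈ Ico a b, ∀ x ∈ Ioo c b, 0 < u x :=
      (mem_nhdsLT_iff_exists_mem_Ico_Ioo_subset hab).1 <|
        ((hu b (right_mem_Icc.2 hab.le)).continuousAt.eventually (lt_mem_nhds hub)).filter_mono
          nhdsWithin_le_nhds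
    have hsub : Icc c b ⊆ Icc a b := Icc_subset_Icc_left hc.1
    have hmono : StrictMonoOn w' (Icc c b) := strictMonoOn_Icc_of_hasDerivAt
      ((continuousOn_of_hasDerivAt hw').mono hsub)
      (fun x hx => hw' x (hsub (Ioo_subset_Icc_self hx))) fun x hx =>
        mul_pos (mul_pos (by norm_num) (hupos x hx)) (hwpos x ⟨hc.1.trans_lt hx.1, hx.2.le⟩)
    exact (hpos c hc).trans (hmono (left_mem_Icc.2 hc.2.le) (right_mem_Icc.2 hc.2.le) hc.2)

theorem deriv_pos_of_three_mul_sq_lt_Ico (hu : ∀ x ∈ Ico a b, HasDerivAt u (u' x) x)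
    (hu' : ∀ x ∈ Ico a b, HasDerivAt u' (u'' x) x)
    (hu'' : ∀ x ∈ Ioo a b, 3 * u x ^ 2 < u'' x) (ha : 0 ≤ u' a)
    (hw : ∀ x ∈ Ico a b, HasDerivAt w (w' x) x)
    (hw' : ∀ x ∈ Ico a b, HasDerivAt w' (6 * u x * w x) x) (hwa : w a = 0) (hwa' : 0 < w' a) :
    ∀ x ∈ Ico a b, 0 < w' x := by
  refine forall_pos_of_forall_Ico_pos (continuousOn_of_hasDerivAt hw') hwa' fun c hc hpos => ?_
  have hsub : Icc a c ⊆ Ico a b := Icc_subset_Ico_right hc.2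
  exact deriv_pos_of_three_mul_sq_lt_of_deriv_pos hc.1 (fun x hx => hu x (hsub hx))
    (fun x hx => hu' x (hsub hx)) (fun x hx => hu'' x ⟨hx.1, hx.2.trans hc.2⟩) ha
    (fun x hx => hw x (hsub hx)) (fun x hx => hw' x (hsub hx)) hwa hpos

end Comparison

section Limits

variable {a b : ℝ} {f f' g g' : ℝ → ℝ}

theorem tendsto_nhds_or_atTop_of_le_deriv {C : ℝ} (hf : ∀ᶠ x in 𝓝[<] b, HasDerivAt f (f' x) x)
    (hC : ∀ᶠ x in 𝓝[<] b, C ≤ f' x) :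
    (∃ l, Tendsto f (𝓝[<] b) (𝓝 l)) ∨ Tendsto f (𝓝[<] b) atTop := by
  obtain ⟨s, hs, h⟩ := (mem_nhdsLT_iff_exists_Ioo_subset' (sub_one_lt b)).1 (hf.and hC)
  have hderiv : ∀ x ∈ Ioo s b, HasDerivAt (fun x => f x - C * x) (f' x - C * 1) x := fun x hx =>
    (h hx).1.sub ((hasDerivAt_id x).const_mul C)
  have hmono : MonotoneOn (fun x => f x - C * x) (Ioo s b) :=
    monotoneOn_of_hasDerivWithinAt_nonneg (convex_Ioo s b) (continuousOn_of_hasDerivAt hderiv)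
      (fun x hx => (hderiv x (interior_subset hx)).hasDerivWithinAt)
      fun x hx => by linarith [(h (interior_subset hx)).2]
  have hlin : Tendsto (fun x => C * x) (𝓝[<] b) (𝓝 (C * b)) :=
    (continuous_const_mul C).continuousWithinAt
  by_cases hbdd : BddAbove ((fun x => f x - C * x) '' Ioo s b)
  · left
    have hlim := (hmono.tendsto_nhdsWithin_Ioo_left (nonempty_Ioo.2 hs) hbdd).add hlin
    simp only [sub_add_cancel] at hlim
    exact ⟨_, hlim⟩
  · right
    have htop : Tendsto (fun x => f x - C * x) (𝓝[<] b) atTop := by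
      refine tendsto_atTop.2 fun B => ?_
      obtain ⟨_, ⟨m, hm, rfl⟩, hB⟩ := not_bddAbove_iff.1 hbdd B
      filter_upwards [Ioo_mem_nhdsLT hm.2] with x hx
      exact hB.le.trans (hmono hm ⟨hm.1.trans hx.1, hx.2⟩ hx.1.le)
    simpa only [sub_add_cancel] using htop.atTop_add hlin

theorem exists_tendsto_nhds_of_tendsto_deriv {l : ℝ}
    (hf : ∀ᶠ x in 𝓝[<] b, HasDerivAt f (f' x) x) (hl : Tendsto f' (𝓝[<] b) (𝓝 l)) :
    ∃ m, Tendsto f (𝓝[<] b) (𝓝 m) := by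
  have hneg : ∀ᶠ x in 𝓝[<] b, HasDerivAt (-f) (-f' x) x := hf.mono fun x hx => hx.neg
  rcases tendsto_nhds_or_atTop_of_le_deriv hf (hl.eventually_const_le (sub_one_lt l)) with h | htop
  · exact h
  rcases tendsto_nhds_or_atTop_of_le_deriv hneg
    (hl.neg.eventually_const_le (sub_one_lt (-l))) with ⟨m, hm⟩ | htop'
  · exact ⟨-m, by simpa using hm.neg⟩
  · exact absurd (tendsto_neg_atTop_iff.1 htop') (htop.not_tendsto disjoint_atTop_atBot)

theorem isBigO_of_deriv_isBigO (hf : ∀ᶠ x in 𝓝[<] b, HasDerivAt f (f' x) x)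
    (hg : ∀ᶠ x in 𝓝[<] b, HasDerivAt g (g' x) x) (hg' : ∀ᶠ x in 𝓝[<] b, 0 ≤ g' x)
    (hO : f' =O[𝓝[<] b] g') (htop : Tendsto g (𝓝[<] b) atTop) : f =O[𝓝[<] b] g := by
  obtain ⟨C, hC⟩ := hO.bound
  obtain ⟨s, hs, h⟩ := (mem_nhdsLT_iff_exists_Ioo_subset' (sub_one_lt b)).1
    (hf.and (hg.and (hg'.and hC)))
  obtain ⟨m, hm⟩ := exists_between (mem_Iio.1 hs)
  have hbound : ∀ x ∈ Ioo m b, ‖f x‖ ≤ ‖f m‖ + C * (g x - g m) := by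
    intro x hx
    have hsub : Icc m x ⊆ Ioo s b := Icc_subset_Ioo hm.1 hx.2
    have hB : ∀ t ∈ Icc m x, HasDerivAt (fun t => ‖f m‖ + C * (g t - g m)) (C * g' t) t :=
      fun t ht => (((h (hsub ht)).2.1.sub_const _).const_mul C).const_add _
    refine image_norm_le_of_norm_deriv_right_le_deriv_boundary'
      (continuousOn_of_hasDerivAt fun t ht => (h (hsub ht)).1)
      (fun t ht => (h (hsub (Ico_subset_Icc_self ht))).1.hasDerivWithinAt) (by simp)
      (continuousOn_of_hasDerivAt hB)
      (fun t ht => (hB t (Ico_subset_Icc_self ht)).hasDerivWithinAt)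
      (fun t ht => ?_) (right_mem_Icc.2 hx.1.le)
    obtain ⟨-, -, hpos, hle⟩ := h (hsub (Ico_subset_Icc_self ht))
    rwa [Real.norm_of_nonneg hpos] at hle
  refine IsBigO.of_bound (C + 1) ?_
  filter_upwards [Ioo_mem_nhdsLT hm.2, htop.eventually_ge_atTop (max 0 (‖f m‖ - C * g m))]
    with x hx hgx
  rw [Real.norm_of_nonneg ((le_max_left _ _).trans hgx)]
  linarith [hbound x hx, (le_max_right _ _).trans hgx]

theorem tendsto_div_sub_of_tendsto_deriv (hf : ∀ᶠ x in 𝓝[<] b, HasDerivAt f (f' x) x)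
    (h0 : Tendsto f (𝓝[<] b) (𝓝 0)) (hf' : Tendsto f' (𝓝[<] b) (𝓝 (-1))) :
    Tendsto (fun x => f x / (b - x)) (𝓝[<] b) (𝓝 1) := by
  refine HasDerivAt.lhopital_zero_nhdsLT hf (g' := fun _ => -1)
    (Eventually.of_forall fun x => (hasDerivAt_id x).const_sub b) (by simp) h0 ?_
    (by simpa using hf'.div_const (-1))
  exact tendsto_nhdsWithin_of_tendsto_nhds ((continuous_sub_left b).tendsto' b 0 (sub_self b))

theorem tendsto_sub_div_cube_of_deriv (hf : ∀ᶠ x in 𝓝[<] b, HasDerivAt f (f' x) x)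
    (h0 : Tendsto f (𝓝[<] b) (𝓝 0))
    (hf' : (fun x => f' x + 1) =o[𝓝[<] b] fun x => (b - x) ^ 2) :
    Tendsto (fun x => (f x - (b - x)) / (b - x) ^ 3) (𝓝[<] b) (𝓝 0) := by
  have hlim : Tendsto (fun x => b - x) (𝓝[<] b) (𝓝 0) :=
    tendsto_nhdsWithin_of_tendsto_nhds ((continuous_sub_left b).tendsto' b 0 (sub_self b))
  refine HasDerivAt.lhopital_zero_nhdsLT (f' := fun x => f' x + 1)
    (g' := fun x => -3 * (b - x) ^ 2) ?_ (Eventually.of_forall fun x => ?_) ?_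
    (by simpa using h0.sub hlim) (by simpa using hlim.pow 3) ?_
  · filter_upwards [hf] with x hx
    exact (hx.sub ((hasDerivAt_id x).const_sub b)).congr_deriv (by ring)
  · exact (((hasDerivAt_id x).const_sub b).pow 3).congr_deriv (by push_cast; simp)
  · filter_upwards [self_mem_nhdsWithin] with x hx
    have : b - x ≠ 0 := (sub_pos.2 hx).ne'
    simpa
  · exact (hf'.const_mul_right (by norm_num : (-3 : ℝ) ≠ 0)).tendsto_div_nhds_zero

theorem tendsto_inv_sq_sub_inv_sq (hf : ∀ᶠ x in 𝓝[<] b, HasDerivAt f (f' x) x)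
    (h0 : Tendsto f (𝓝[<] b) (𝓝 0))
    (hf' : (fun x => f' x + 1) =o[𝓝[<] b] fun x => f x ^ 2) :
    Tendsto (fun x => (f x ^ 2)⁻¹ - ((b - x) ^ 2)⁻¹) (𝓝[<] b) (𝓝 0) := by
  have hf'_lim : Tendsto f' (𝓝[<] b) (𝓝 (-1)) := by
    simpa using (hf'.trans_tendsto (by simpa using h0.pow 2)).sub_const 1
  have hne : ∀ᶠ x in 𝓝[<] b, b - x ≠ 0 := by
    filter_upwards [self_mem_nhdsWithin] with x hx using (sub_pos.2 hx).ne'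
  have hratio := tendsto_div_sub_of_tendsto_deriv hf h0 hf'_lim
  have hO : f =O[𝓝[<] b] fun x => b - x :=
    isBigO_of_div_tendsto_nhds (hne.mono fun x hx h => absurd h hx) 1 hratio
  have hcube := tendsto_sub_div_cube_of_deriv hf h0 (hf'.trans_isBigO (hO.pow 2))
  have hlim := (hcube.neg.mul (hratio.add_const 1)).div (hratio.pow 2) (by norm_num)
  rw [neg_zero, zero_mul, zero_div] at hlim
  refine hlim.congr' ?_
  filter_upwards [hne, hratio.eventually_ne one_ne_zero] with x hx hfx
  have : f x ≠ 0 := fun h => hfx (by simp [h])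
  simp only [Pi.div_apply]
  field_simp
  ring

end Limits

section System

variable {σ : ℝ} {I J : Set ℝ} {y p z q : ℝ → ℝ}

theorem SolvesOn.congr (hI : IsOpen I) (h : SolvesOn I y) (hzy : EqOn z y I) : SolvesOn I z := by
  intro x hx
  have hev : z =ᶠ[𝓝 x] y := hzy.eventuallyEq_of_mem (hI.mem_nhds hx)
  exact ⟨(h x hx).1.congr_of_eventuallyEq hev,
    hzy hx ▸ (h x hx).2.congr_of_eventuallyEq hev.deriv⟩

/-- The first order system `y' = p`, `p' = 6 y ^ 2 + σ x` on the set `I`. For `σ = -1` this is the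
first Painlevé equation; the parameter `σ` is there because the reflection `x ↦ -x` turns `σ` into
`-σ`. -/
def SystemOn (σ : ℝ) (I : Set ℝ) (y p : ℝ → ℝ) : Prop :=
  ∀ x ∈ I, HasDerivAt y (p x) x ∧ HasDerivAt p (6 * y x ^ 2 + σ * x) x

theorem SystemOn.mono (h : SystemOn σ I y p) (hJ : J ⊆ I) : SystemOn σ J y p :=
  fun x hx => h x (hJ hx)

theorem SolvesOn.systemOn (h : SolvesOn I y) : SystemOn (-1) I y (deriv y) := fun x hx =>
  ⟨(h x hx).1.hasDerivAt, (h x hx).2.congr_deriv (by ring)⟩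

theorem SystemOn.solvesOn (hI : IsOpen I) (h : SystemOn (-1) I y p) : SolvesOn I y := by
  intro x hx
  have hderiv : deriv y =ᶠ[𝓝 x] p := by
    filter_upwards [hI.mem_nhds hx] with t ht using (h t ht).1.deriv
  exact ⟨(h x hx).1.differentiableAt,
    ((h x hx).2.congr_of_eventuallyEq hderiv).congr_deriv (by ring)⟩

theorem SystemOn.reflect (h : SystemOn σ I y p) :
    SystemOn (-σ) (Neg.neg ⁻¹' I) (fun x => y (-x)) (fun x => -p (-x)) := by
  intro x hx
  obtain ⟨hy, hp⟩ := h (-x) hx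
  exact ⟨(hy.scomp x (hasDerivAt_neg x)).congr_deriv (by simp),
    (hp.scomp x (hasDerivAt_neg x)).neg.congr_deriv (by rw [smul_eq_mul]; ring)⟩

theorem SystemOn.continuousOn (h : SystemOn σ I y p) : ContinuousOn y I :=
  fun x hx => (h x hx).1.continuousAt.continuousWithinAt

theorem SystemOn.hasDerivAt_deriv_sub (hy : SystemOn σ I y p) (hz : SystemOn σ I z q) {x : ℝ}
    (hx : x ∈ I) :
    HasDerivAt (fun t => p t - q t) (6 * (y x + z x) * (y x - z x)) x :=
  ((hy x hx).2.sub (hz x hx).2).congr_deriv (by ring)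

theorem SystemOn.hasDerivAt_deriv_add (hy : SystemOn σ I y p) (hz : SystemOn σ I z q) {x : ℝ}
    (hx : x ∈ I) :
    HasDerivAt (fun t => p t + q t) (3 * (y x + z x) ^ 2 + 3 * (y x - z x) ^ 2 + 2 * σ * x) x :=
  ((hy x hx).2.add (hz x hx).2).congr_deriv (by ring)

theorem SystemOn.eq_of_le {a b : ℝ} (hab : a ≤ b) (hy : SystemOn σ (Icc a b) y p)
    (hz : SystemOn σ (Icc a b) z q) (h0 : y a = z a) (h1 : p a = q a) : y b = z b := by
  set F : ℝ → ℝ × ℝ := fun x => (y x - z x, p x - q x) with hF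
  set F' : ℝ → ℝ × ℝ := fun x => (p x - q x, 6 * (y x + z x) * (y x - z x))
  have hderiv : ∀ x ∈ Icc a b, HasDerivAt F (F' x) x := fun x hx =>
    ((hy x hx).1.sub (hz x hx).1).prodMk (hy.hasDerivAt_deriv_sub hz hx)
  obtain ⟨K, hK⟩ := isCompact_Icc.exists_bound_of_continuousOn
    ((hy.continuousOn.add hz.continuousOn).const_mul 6)
  have hbound : ∀ x ∈ Ico a b, ‖F' x‖ ≤ max 1 K * ‖F x‖ := by
    intro x hx
    refine norm_prod_le_iff.2 ⟨?_, ?_⟩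
    · calc ‖p x - q x‖ ≤ ‖F x‖ := norm_snd_le (F x)
        _ ≤ max 1 K * ‖F x‖ := le_mul_of_one_le_left (norm_nonneg _) (le_max_left 1 K)
    · rw [norm_mul]
      gcongr
      · exact (hK x (Ico_subset_Icc_self hx)).trans (le_max_right 1 K)
      · exact norm_fst_le (F x)
  have hzero := eq_zero_of_abs_deriv_le_mul_abs_self_of_eq_zero_right
    (fun x hx => (hderiv x hx).continuousAt.continuousWithinAt)
    (fun x hx => (hderiv x (Ico_subset_Icc_self hx)).hasDerivWithinAt)
    (by simp [hF, h0, h1]) hbound b (right_mem_Icc.2 hab)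
  exact sub_eq_zero.1 (congrArg Prod.fst hzero)

theorem SystemOn.eqOn (hI : I.OrdConnected) (hy : SystemOn σ I y p) (hz : SystemOn σ I z q) {a : ℝ}
    (ha : a ∈ I) (h0 : y a = z a) (h1 : p a = q a) : EqOn y z I := by
  intro b hb
  rcases le_total a b with hab | hba
  · have hsub : Icc a b ⊆ I := hI.out ha hb
    exact (hy.mono hsub).eq_of_le hab (hz.mono hsub) h0 h1
  · have hsub : Icc (-a) (-b) ⊆ Neg.neg ⁻¹' I := fun x hx =>
      hI.out hb ha ⟨le_neg.1 hx.2, neg_le.1 hx.1⟩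
    simpa using (hy.reflect.mono hsub).eq_of_le (neg_le_neg hba) (hz.reflect.mono hsub)
      (by simpa using h0) (by simpa using h1)

end System

section Transversal

variable {σ a b c : ℝ} {y₁ y₂ p₁ p₂ : ℝ → ℝ}

theorem SystemOn.not_tendsto_sub_of_deriv_pos (hab : a < b) (hσ : ∀ x ∈ Ioo a b, 0 < σ * x)
    (h₁ : SystemOn σ (Ico a b) y₁ p₁) (h₂ : SystemOn σ (Ico a b) y₂ p₂) (ha : y₁ a = y₂ a)
    (hsum : 0 ≤ p₁ a + p₂ a) (hp : 0 < p₁ a - p₂ a) :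
    ¬ Tendsto (fun x => y₁ x - y₂ x) (𝓝[<] b) (𝓝 0) := by
  set w : ℝ → ℝ := fun x => y₁ x - y₂ x with hw_def
  have hw : ∀ x ∈ Ico a b, HasDerivAt w (p₁ x - p₂ x) x := fun x hx =>
    (h₁ x hx).1.sub (h₂ x hx).1
  have hpos := deriv_pos_of_three_mul_sq_lt_Ico (u := fun x => y₁ x + y₂ x)
    (fun x hx => (h₁ x hx).1.add (h₂ x hx).1) (fun x hx => h₁.hasDerivAt_deriv_add h₂ hx)
    (fun x hx => by nlinarith [hσ x hx, sq_nonneg (y₁ x - y₂ x)]) hsum hw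
    (fun x hx => h₁.hasDerivAt_deriv_sub h₂ hx) (sub_eq_zero.2 ha) hp
  have hmono : StrictMonoOn w (Ico a b) :=
    strictMonoOn_of_hasDerivWithinAt_pos (convex_Ico a b) (continuousOn_of_hasDerivAt hw)
      (fun x hx => (hw x (interior_subset hx)).hasDerivWithinAt)
      fun x hx => hpos x (interior_subset hx)
  obtain ⟨c, hac, hcb⟩ := exists_between hab
  have hwc : 0 < w c := by
    simpa only [hw_def, sub_eq_zero.2 ha] using hmono ⟨le_rfl, hab⟩ ⟨hac.le, hcb⟩ hac
  intro hlim
  refine hwc.not_ge (ge_of_tendsto hlim ?_)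
  filter_upwards [Ioo_mem_nhdsLT hcb] with x hx
  exact (hmono ⟨hac.le, hcb⟩ ⟨hac.le.trans hx.1.le, hx.2⟩ hx.1).le

theorem SystemOn.not_tendsto_sub (hab : a < b) (hσ : ∀ x ∈ Ioo a b, 0 < σ * x)
    (h₁ : SystemOn σ (Ico a b) y₁ p₁) (h₂ : SystemOn σ (Ico a b) y₂ p₂) (ha : y₁ a = y₂ a)
    (hsum : 0 ≤ p₁ a + p₂ a) (hp : p₁ a ≠ p₂ a) :
    ¬ Tendsto (fun x => y₁ x - y₂ x) (𝓝[<] b) (𝓝 0) := by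
  rcases hp.lt_or_gt with hlt | hgt
  · intro hlim
    refine h₂.not_tendsto_sub_of_deriv_pos hab hσ h₁ ha.symm (add_comm (p₁ a) _ ▸ hsum)
      (sub_pos.2 hlt) ?_
    simpa only [neg_sub, neg_zero] using hlim.neg
  · exact h₁.not_tendsto_sub_of_deriv_pos hab hσ h₂ ha hsum (sub_pos.2 hgt)

theorem SystemOn.not_tendsto_sub_nhdsGT_of_tendsto_sub_nhdsLT (hab : a < b) (hbc : b < c)
    (hc : c ≤ 0) (h₁ : SystemOn (-1) (Ioo a c) y₁ p₁) (h₂ : SystemOn (-1) (Ioo a c) y₂ p₂)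
    (hb : y₁ b = y₂ b) (hp : p₁ b ≠ p₂ b)
    (hright : Tendsto (fun x => y₁ x - y₂ x) (𝓝[<] c) (𝓝 0)) :
    ¬ Tendsto (fun x => y₁ x - y₂ x) (𝓝[>] a) (𝓝 0) := by
  have hsubR : Ico b c ⊆ Ioo a c := Ico_subset_Ioo_left hab
  have hsubL : Ico (-b) (-a) ⊆ Neg.neg ⁻¹' Ioo a c := fun x hx =>
    ⟨lt_neg.1 hx.2, (neg_le.1 hx.1).trans_lt hbc⟩
  rcases le_total 0 (p₁ b + p₂ b) with hsum | hsum
  · exact absurd hright ((h₁.mono hsubR).not_tendsto_sub hbc (fun x hx => by linarith [hx.2])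
      (h₂.mono hsubR) hb hsum hp)
  · intro hleft
    refine (h₁.reflect.mono hsubL).not_tendsto_sub (neg_lt_neg hab)
      (fun x hx => by linarith [hx.1]) (h₂.reflect.mono hsubL) (by simpa using hb)
      (by simpa using by linarith) (by simpa using hp) ?_
    exact hleft.comp (tendsto_neg_nhdsLT_neg)

end Transversal

section Pole

variable {σ a b : ℝ} {y p : ℝ → ℝ}

-- Time is made the first component of the state, so that the vector field is autonomous.
theorem exists_systemOn_of_mem_closedBall (σ : ℝ) (v₀ : ℝ × ℝ × ℝ) :
    ∃ r > 0, ∃ ε > 0, ∀ v ∈ Metric.closedBall v₀ r, ∃ z q,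
      SystemOn σ (Ioo (v.1 - ε) (v.1 + ε)) z q ∧ z v.1 = v.2.1 ∧ q v.1 = v.2.2 := by
  set F : ℝ × ℝ × ℝ → ℝ × ℝ × ℝ := fun v => (1, v.2.2, 6 * v.2.1 ^ 2 + σ * v.1) with hF
  have hFc : ContDiff ℝ 1 F := by fun_prop
  obtain ⟨r, hr, ε, hε, hflow⟩ :=
    (hFc.contDiffAt (x := v₀)).exists_forall_mem_closedBall_exists_eq_forall_mem_Ioo_hasDerivAt 0
  refine ⟨r, hr, ε, hε, fun v hv => ?_⟩
  obtain ⟨γ, hγ0, hγ⟩ := hflow v hv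
  have htime : ∀ t ∈ Ioo (0 - ε) (0 + ε), (γ t).1 = v.1 + t := by
    intro t ht
    have hderiv : ∀ s ∈ Ioo (0 - ε) (0 + ε), HasDerivAt (fun s => (γ s).1 - s) 0 s :=
      fun s hs => by
        have hfst : HasDerivAt (fun s => (γ s).1) 1 s := (hγ s hs).fst
        exact (hfst.sub (hasDerivAt_id s)).congr_deriv (sub_self 1)
    have := isOpen_Ioo.is_const_of_deriv_eq_zero isPreconnected_Ioo
      (fun s hs => (hderiv s hs).differentiableAt.differentiableWithinAt)
      (fun s hs => (hderiv s hs).deriv) ht (y := 0) (by simpa using hε)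
    simp only [hγ0] at this
    linarith
  refine ⟨fun x => (γ (x - v.1)).2.1, fun x => (γ (x - v.1)).2.2, fun x hx => ?_,
    by simp [hγ0], by simp [hγ0]⟩
  have ht : x - v.1 ∈ Ioo (0 - ε) (0 + ε) := ⟨by linarith [hx.1], by linarith [hx.2]⟩
  have hstate : HasDerivAt (fun x => (γ (x - v.1)).2) (F (γ (x - v.1))).2 x :=
    ((hγ _ ht).comp_sub_const x v.1).snd
  have hq : HasDerivAt (fun x => (γ (x - v.1)).2.2) (F (γ (x - v.1))).2.2 x := hstate.snd
  exact ⟨hstate.fst, by simpa [hF, htime _ ht] using hq⟩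

theorem SystemOn.exists_extension {y₀ p₀ : ℝ} (hab : a < b) (h : SystemOn σ (Ioo a b) y p)
    (hy : Tendsto y (𝓝[<] b) (𝓝 y₀)) (hp : Tendsto p (𝓝[<] b) (𝓝 p₀)) :
    ∃ s ∈ Ico a b, ∃ c > b, ∃ z q, SystemOn σ (Ioo s c) z q ∧ EqOn z y (Ioo s b) := by
  obtain ⟨r, hr, ε, hε, hlocal⟩ := exists_systemOn_of_mem_closedBall σ (b, y₀, p₀)
  have hlim : Tendsto (fun x => (x, y x, p x)) (𝓝[<] b) (𝓝 (b, y₀, p₀)) :=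
    (tendsto_nhdsWithin_of_tendsto_nhds tendsto_id).prodMk_nhds (hy.prodMk_nhds hp)
  have hnear : ∀ᶠ t in 𝓝[<] b, t ∈ Ioo a b ∩ Ioo (b - ε) b :=
    inter_mem (Ioo_mem_nhdsLT hab) (Ioo_mem_nhdsLT (sub_lt_self b hε))
  obtain ⟨t, htr, htab, htε⟩ :=
    ((hlim.eventually (Metric.closedBall_mem_nhds _ hr)).and hnear).exists
  obtain ⟨z, q, hzq, hz, hq⟩ := hlocal _ htr
  have hbt : b < t + ε := by linarith [htε.1]
  have hts : max a (t - ε) < t := max_lt htab.1 (by linarith)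
  refine ⟨max a (t - ε), ⟨le_max_left _ _, hts.trans htab.2⟩, t + ε, hbt, z, q,
    hzq.mono (Ioo_subset_Ioo_left (le_max_right _ _)), ?_⟩
  exact SystemOn.eqOn ordConnected_Ioo (hzq.mono (Ioo_subset_Ioo (le_max_right _ _) hbt.le))
    (h.mono (Ioo_subset_Ioo_left (le_max_left _ _))) ⟨hts, htab.2⟩ hz hq

theorem SystemOn.tendsto_atTop (hab : a < b) (h : SystemOn σ (Ioo a b) y p)
    (hne : ∀ y₀ p₀, Tendsto y (𝓝[<] b) (𝓝 y₀) → ¬ Tendsto p (𝓝[<] b) (𝓝 p₀)) :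
    Tendsto y (𝓝[<] b) atTop ∧ Tendsto p (𝓝[<] b) atTop := by
  have hev : ∀ᶠ x in 𝓝[<] b, x ∈ Ioo a b := Ioo_mem_nhdsLT hab
  have hy' := hev.mono fun x hx => (h x hx).1
  have hp' := hev.mono fun x hx => (h x hx).2
  have hσ : Tendsto (fun x => σ * x) (𝓝[<] b) (𝓝 (σ * b)) :=
    (continuous_const_mul σ).continuousWithinAt
  have hp_top : Tendsto p (𝓝[<] b) atTop := by
    refine (tendsto_nhds_or_atTop_of_le_deriv hp' (C := σ * b - 1) ?_).resolve_left ?_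
    · filter_upwards [hσ.eventually_const_le (sub_one_lt _)] with x hx
      linarith [sq_nonneg (y x)]
    · rintro ⟨p₀, hp₀⟩
      obtain ⟨y₀, hy₀⟩ := exists_tendsto_nhds_of_tendsto_deriv hy' hp₀
      exact hne y₀ p₀ hy₀ hp₀
  refine ⟨(tendsto_nhds_or_atTop_of_le_deriv hy' (hp_top.eventually_ge_atTop 0)).resolve_left ?_,
    hp_top⟩
  rintro ⟨y₀, hy₀⟩
  obtain ⟨p₀, hp₀⟩ := exists_tendsto_nhds_of_tendsto_deriv hp' (((hy₀.pow 2).const_mul 6).add hσ)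
  exact not_tendsto_nhds_of_tendsto_atTop hp_top p₀ hp₀

theorem SystemOn.sq_sub_four_mul_cube_isBigO (hab : a < b) (h : SystemOn σ (Ioo a b) y p)
    (hy : Tendsto y (𝓝[<] b) atTop) (hp : Tendsto p (𝓝[<] b) atTop) :
    (fun x => p x ^ 2 - 4 * y x ^ 3) =O[𝓝[<] b] y := by
  have hev : ∀ᶠ x in 𝓝[<] b, x ∈ Ioo a b := Ioo_mem_nhdsLT hab
  refine isBigO_of_deriv_isBigO (f' := fun x => 2 * σ * x * p x) (g' := p)
    (hev.mono fun x hx => ?_) (hev.mono fun x hx => (h x hx).1) (hp.eventually_ge_atTop 0) ?_ hy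
  · exact (((h x hx).2.pow 2).sub (((h x hx).1.pow 3).const_mul 4)).congr_deriv
      (by push_cast; ring)
  · have hlim : Tendsto (fun x => 2 * σ * x) (𝓝[<] b) (𝓝 (2 * σ * b)) :=
      (continuous_const_mul _).continuousWithinAt
    simpa using (hlim.isBigO_one ℝ).mul (isBigO_refl p _)

theorem one_sub_div_sqrt_cube_isLittleO {l : Filter ℝ} (hy : Tendsto y l atTop)
    (hp : ∀ᶠ x in l, 0 ≤ p x) (hO : (fun x => p x ^ 2 - 4 * y x ^ 3) =O[l] y) :
    (fun x => 1 - p x / (2 * √(y x) ^ 3)) =o[l] fun x => (y x)⁻¹ := by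
  set ρ : ℝ → ℝ := fun x => p x / (2 * √(y x) ^ 3) with hρ
  have hy_pos := hy.eventually_gt_atTop 0
  have hρ_sq : ∀ᶠ x in l, 1 - ρ x ^ 2 = -1 / 4 * ((p x ^ 2 - 4 * y x ^ 3) * (y x ^ 3)⁻¹) := by
    filter_upwards [hy_pos] with x hyx
    rw [hρ, div_pow, mul_pow, ← pow_mul, mul_comm 3, pow_mul, Real.sq_sqrt hyx.le]
    field_simp
    ring
  have hy_inv : (fun x => y x * (y x ^ 3)⁻¹) =o[l] fun x => (y x)⁻¹ := by
    have hone : (fun x => (y x)⁻¹) =o[l] (fun _ => (1 : ℝ)) :=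
      (isLittleO_one_iff ℝ).2 hy.inv_tendsto_atTop
    refine (hone.mul_isBigO (isBigO_refl (fun x => (y x)⁻¹) l)).congr' ?_ (by simp)
    filter_upwards [hy_pos] with x hyx
    field_simp
  have hsq : (fun x => 1 - ρ x ^ 2) =o[l] fun x => (y x)⁻¹ :=
    (((hO.mul (isBigO_refl _ l)).const_mul_left (-1 / 4)).trans_isLittleO hy_inv).congr'
      (hρ_sq.mono fun x hx => hx.symm) .rfl
  refine IsBigO.trans_isLittleO (IsBigO.of_bound 1 ?_) hsq
  filter_upwards [hp] with x hpx
  have hρx : 0 ≤ ρ x := by positivity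
  rw [one_mul, show 1 - ρ x ^ 2 = (1 - ρ x) * (1 + ρ x) by ring, norm_mul]
  refine le_mul_of_one_le_right (norm_nonneg _) ?_
  rw [Real.norm_of_nonneg (by linarith)]
  linarith

theorem SystemOn.tendsto_sub_inv_sq (hab : a < b) (h : SystemOn σ (Ioo a b) y p)
    (hy : Tendsto y (𝓝[<] b) atTop) (hp : Tendsto p (𝓝[<] b) atTop) :
    Tendsto (fun x => y x - ((b - x) ^ 2)⁻¹) (𝓝[<] b) (𝓝 0) := by
  have hev : ∀ᶠ x in 𝓝[<] b, x ∈ Ioo a b := Ioo_mem_nhdsLT hab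
  have hy_pos := hy.eventually_gt_atTop 0
  have hderiv : ∀ᶠ x in 𝓝[<] b,
      HasDerivAt (fun x => (√(y x))⁻¹) (-(p x / (2 * √(y x) ^ 3))) x := by
    filter_upwards [hev, hy_pos] with x hx hyx
    have hsqrt : √(y x) ≠ 0 := (Real.sqrt_pos.2 hyx).ne'
    refine (((h x hx).1.sqrt hyx.ne').inv hsqrt).congr_deriv ?_
    field_simp
  have hsq : ∀ᶠ x in 𝓝[<] b, (√(y x))⁻¹ ^ 2 = (y x)⁻¹ := hy_pos.mono fun x hyx => by
    rw [inv_pow, Real.sq_sqrt hyx.le]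
  have hlittle := (one_sub_div_sqrt_cube_isLittleO hy (hp.eventually_ge_atTop 0)
    (h.sq_sub_four_mul_cube_isBigO hab hy hp)).congr'
      (.of_forall fun x => (neg_add_eq_sub _ _).symm) (hsq.mono fun x hx => hx.symm)
  refine (tendsto_inv_sq_sub_inv_sq hderiv
    (Real.tendsto_sqrt_atTop.comp hy).inv_tendsto_atTop hlittle).congr' ?_
  filter_upwards [hsq] with x hx
  rw [hx, inv_inv]

theorem SystemOn.exists_extension_or_tendsto_nhdsLT (hab : a < b) (h : SystemOn σ (Ioo a b) y p) :
    (∃ s ∈ Ico a b, ∃ c > b, ∃ z q, SystemOn σ (Ioo s c) z q ∧ EqOn z y (Ioo s b)) ∨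
      Tendsto (fun x => y x - ((b - x) ^ 2)⁻¹) (𝓝[<] b) (𝓝 0) := by
  by_cases hlim : ∃ y₀ p₀, Tendsto y (𝓝[<] b) (𝓝 y₀) ∧ Tendsto p (𝓝[<] b) (𝓝 p₀)
  · obtain ⟨y₀, p₀, hy, hp⟩ := hlim
    exact .inl (h.exists_extension hab hy hp)
  · obtain ⟨hy, hp⟩ := h.tendsto_atTop hab fun y₀ p₀ hy hp => hlim ⟨y₀, p₀, hy, hp⟩
    exact .inr (h.tendsto_sub_inv_sq hab hy hp)

theorem SystemOn.exists_extension_or_tendsto_nhdsGT (hab : a < b) (h : SystemOn σ (Ioo a b) y p) :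
    (∃ s ∈ Ioc a b, ∃ c < a, ∃ z q, SystemOn σ (Ioo c s) z q ∧ EqOn z y (Ioo a s)) ∨
      Tendsto (fun x => y x - ((x - a) ^ 2)⁻¹) (𝓝[>] a) (𝓝 0) := by
  have hreflect : SystemOn (-σ) (Ioo (-b) (-a)) (fun x => y (-x)) (fun x => -p (-x)) := by
    simpa only [neg_preimage, neg_Ioo] using h.reflect
  refine (hreflect.exists_extension_or_tendsto_nhdsLT (neg_lt_neg hab)).imp ?_ fun hlim => ?_
  · rintro ⟨s, hs, c, hc, z, q, hzq, hzy⟩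
    refine ⟨-s, ⟨lt_neg.1 hs.2, neg_le.1 hs.1⟩, -c, neg_lt.1 hc, fun x => z (-x),
      fun x => -q (-x), ?_, fun x hx => ?_⟩
    · simpa only [neg_preimage, neg_Ioo, neg_neg] using hzq.reflect
    · simpa using hzy (x := -x) ⟨lt_neg.1 hx.2, neg_lt_neg hx.1⟩
  · refine (hlim.comp tendsto_neg_nhdsGT).congr fun x => ?_
    simp only [Function.comp_apply, neg_neg, neg_sub_neg]

end Pole

section IntervalOfExistence

variable {I J : Set ℝ} {y z : ℝ → ℝ} {a b : ℝ}

theorem IsSolution.ordConnected (h : IsSolution I y) : I.OrdConnected :=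
  h.isConnected.isPreconnected.ordConnected

theorem IsSolution.subset (h : IsSolution I y) (hJ : IsOpen J) (hJc : IsPreconnected J)
    (hIJ : (I ∩ J).Nonempty) (hz : SolvesOn J z) (heq : EqOn z y (I ∩ J)) : J ⊆ I := by
  classical
  have hzJ : EqOn (I.piecewise y z) z J := fun x hx => by
    by_cases hxI : x ∈ I
    · rw [piecewise_eq_of_mem _ _ _ hxI, heq ⟨hxI, hx⟩]
    · exact piecewise_eq_of_notMem _ _ _ hxI
  have hunion : SolvesOn (I ∪ J) (I.piecewise y z) := fun x hx => hx.elim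
    (h.solves.congr h.isOpen (piecewise_eqOn I y z) x) (hz.congr hJ hzJ x)
  have hconn : IsConnected (I ∪ J) :=
    ⟨h.isConnected.nonempty.inl, h.isConnected.isPreconnected.union' hIJ hJc⟩
  exact h.maximal _ _ (h.isOpen.union hJ) hconn subset_union_left hunion (piecewise_eqOn I y z) ▸
    subset_union_right

theorem IsSolution.tendsto_sub_inv_sq_nhdsLT (h : IsSolution I y) (hab : a < b)
    (hsub : Ioo a b ⊆ I) (hb : b ∉ I) :
    Tendsto (fun x => y x - ((b - x) ^ 2)⁻¹) (𝓝[<] b) (𝓝 0) := by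
  refine ((h.solves.systemOn.mono hsub).exists_extension_or_tendsto_nhdsLT hab).resolve_left ?_
  rintro ⟨s, hs, c, hc, z, q, hzq, hzy⟩
  obtain ⟨m, hm⟩ := exists_between hs.2
  have hmI : m ∈ I := hsub ⟨hs.1.trans_lt hm.1, hm.2⟩
  have hlt : ∀ x ∈ I, x < b := fun x hx =>
    lt_of_not_ge fun hbx => hb (h.ordConnected.out hmI hx ⟨hm.2.le, hbx⟩)
  exact hb <| h.subset isOpen_Ioo isPreconnected_Ioo ⟨m, hmI, hm.1, hm.2.trans hc⟩
    (hzq.solvesOn isOpen_Ioo) (fun x hx => hzy ⟨hx.2.1, hlt x hx.1⟩) ⟨hs.2, hc⟩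

theorem IsSolution.tendsto_sub_inv_sq_nhdsGT (h : IsSolution I y) (hab : a < b)
    (hsub : Ioo a b ⊆ I) (ha : a ∉ I) :
    Tendsto (fun x => y x - ((x - a) ^ 2)⁻¹) (𝓝[>] a) (𝓝 0) := by
  refine ((h.solves.systemOn.mono hsub).exists_extension_or_tendsto_nhdsGT hab).resolve_left ?_
  rintro ⟨s, hs, c, hc, z, q, hzq, hzy⟩
  obtain ⟨m, hm⟩ := exists_between hs.1
  have hmI : m ∈ I := hsub ⟨hm.1, hm.2.trans_le hs.2⟩
  have hlt : ∀ x ∈ I, a < x := fun x hx =>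
    lt_of_not_ge fun hxa => ha (h.ordConnected.out hx hmI ⟨hxa, hm.1.le⟩)
  exact ha <| h.subset isOpen_Ioo isPreconnected_Ioo ⟨m, hmI, hc.trans hm.1, hm.2⟩
    (hzq.solvesOn isOpen_Ioo) (fun x hx => hzy ⟨hlt x hx.1, hx.2.2⟩) ⟨hc, hs.1⟩

end IntervalOfExistence

section Intersection

variable {I I₁ I₂ : Set ℝ} {y y₁ y₂ : ℝ → ℝ} {a b : ℝ} {P Q R : ℝ × OnePoint ℝ}

theorem IsEndPoint.notMem (hI : IsOpen I) (h : IsEndPoint I a) : a ∉ I := by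
  intro ha
  obtain ⟨l, u, ⟨hla, hau⟩, hsub⟩ := mem_nhds_iff_exists_Ioo_subset.1 (hI.mem_nhds ha)
  rcases h with hglb | hlub
  · obtain ⟨t, hlt, hta⟩ := exists_between hla
    exact hta.not_ge (hglb.1 (hsub ⟨hlt, hta.trans hau⟩))
  · obtain ⟨t, hat, htu⟩ := exists_between hau
    exact hat.not_ge (hlub.1 (hsub ⟨hla.trans hat, htu⟩))

theorem fst_mem_closure_of_mem_extendedGraph (hI : I.Nonempty) (hP : P ∈ extendedGraph I y) :
    P.1 ∈ closure I := by
  rcases hP with ⟨hPI, -⟩ | ⟨hglb | hlub, -⟩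
  · exact subset_closure hPI
  · exact hglb.mem_closure hI
  · exact hlub.mem_closure hI

theorem mem_intersectionPoints_cases (h : P ∈ intersectionPoints I₁ y₁ I₂ y₂) :
    (P.1 ∈ I₁ ∧ P.1 ∈ I₂ ∧ y₁ P.1 = y₂ P.1 ∧ P.2 = ((y₁ P.1 : ℝ) : OnePoint ℝ)) ∨
      (IsEndPoint I₁ P.1 ∧ IsEndPoint I₂ P.1 ∧ P.2 = OnePoint.infty) := by
  obtain ⟨h₁ | h₁, h₂ | h₂⟩ := h
  · exact .inl ⟨h₁.1, h₂.1, OnePoint.coe_injective (h₁.2.symm.trans h₂.2), h₁.2⟩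
  · exact absurd (h₁.2.symm.trans h₂.2) (OnePoint.coe_ne_infty _)
  · exact absurd (h₂.2.symm.trans h₁.2) (OnePoint.coe_ne_infty _)
  · exact .inr ⟨h₁.1, h₂.1, h₁.2⟩

theorem injOn_fst_intersectionPoints (hI : IsOpen I₁) :
    InjOn Prod.fst (intersectionPoints I₁ y₁ I₂ y₂) := by
  intro P hP Q hQ hPQ
  refine Prod.ext hPQ ?_
  rcases mem_intersectionPoints_cases hP with ⟨hPI, -, -, hP⟩ | ⟨hPe, -, hP⟩ <;>
    rcases mem_intersectionPoints_cases hQ with ⟨hQI, -, -, hQ⟩ | ⟨hQe, -, hQ⟩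
  · rw [hP, hQ, hPQ]
  · exact absurd (hPQ ▸ hPI) (hQe.notMem hI)
  · exact absurd (hPQ ▸ hQI) (hPe.notMem hI)
  · rw [hP, hQ]

theorem IsSolution.deriv_ne (h₁ : IsSolution I₁ y₁) (h₂ : IsSolution I₂ y₂)
    (hne : ¬ (I₁ = I₂ ∧ EqOn y₁ y₂ I₁)) (ha₁ : a ∈ I₁) (ha₂ : a ∈ I₂) (heq : y₁ a = y₂ a) :
    deriv y₁ a ≠ deriv y₂ a := by
  intro hderiv
  have hon : EqOn y₁ y₂ (I₁ ∩ I₂) :=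
    SystemOn.eqOn (h₁.ordConnected.inter h₂.ordConnected)
      (h₁.solves.systemOn.mono inter_subset_left) (h₂.solves.systemOn.mono inter_subset_right)
      ⟨ha₁, ha₂⟩ heq hderiv
  have h21 : I₂ ⊆ I₁ :=
    h₁.subset h₂.isOpen h₂.isConnected.isPreconnected ⟨a, ha₁, ha₂⟩ h₂.solves hon.symm
  have h12 : I₁ ⊆ I₂ :=
    h₂.subset h₁.isOpen h₁.isConnected.isPreconnected ⟨a, ha₂, ha₁⟩ h₁.solves
      (by rwa [inter_comm])
  exact hne ⟨h12.antisymm h21, fun t ht => hon ⟨ht, h12 ht⟩⟩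

theorem IsSolution.tendsto_sub_nhds (h₁ : IsSolution I₁ y₁) (h₂ : IsSolution I₂ y₂)
    (ha₁ : a ∈ I₁) (ha₂ : a ∈ I₂) (heq : y₁ a = y₂ a) :
    Tendsto (fun x => y₁ x - y₂ x) (𝓝 a) (𝓝 0) :=
  sub_eq_zero.2 heq ▸
    ((h₁.solves a ha₁).1.continuousAt.sub (h₂.solves a ha₂).1.continuousAt).tendsto

theorem IsSolution.tendsto_sub_nhdsLT (h₁ : IsSolution I₁ y₁) (h₂ : IsSolution I₂ y₂)
    (hP : P ∈ intersectionPoints I₁ y₁ I₂ y₂) (ha : a < P.1) (hs₁ : Ioo a P.1 ⊆ I₁)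
    (hs₂ : Ioo a P.1 ⊆ I₂) : Tendsto (fun x => y₁ x - y₂ x) (𝓝[<] P.1) (𝓝 0) := by
  rcases mem_intersectionPoints_cases hP with ⟨hP₁, hP₂, heq, -⟩ | ⟨he₁, he₂, -⟩
  · exact (h₁.tendsto_sub_nhds h₂ hP₁ hP₂ heq).mono_left nhdsWithin_le_nhds
  · simpa using (h₁.tendsto_sub_inv_sq_nhdsLT ha hs₁ (he₁.notMem h₁.isOpen)).sub
      (h₂.tendsto_sub_inv_sq_nhdsLT ha hs₂ (he₂.notMem h₂.isOpen))

theorem IsSolution.tendsto_sub_nhdsGT (h₁ : IsSolution I₁ y₁) (h₂ : IsSolution I₂ y₂)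
    (hP : P ∈ intersectionPoints I₁ y₁ I₂ y₂) (hb : P.1 < b) (hs₁ : Ioo P.1 b ⊆ I₁)
    (hs₂ : Ioo P.1 b ⊆ I₂) : Tendsto (fun x => y₁ x - y₂ x) (𝓝[>] P.1) (𝓝 0) := by
  rcases mem_intersectionPoints_cases hP with ⟨hP₁, hP₂, heq, -⟩ | ⟨he₁, he₂, -⟩
  · exact (h₁.tendsto_sub_nhds h₂ hP₁ hP₂ heq).mono_left nhdsWithin_le_nhds
  · simpa using (h₁.tendsto_sub_inv_sq_nhdsGT hb hs₁ (he₁.notMem h₁.isOpen)).sub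
      (h₂.tendsto_sub_inv_sq_nhdsGT hb hs₂ (he₂.notMem h₂.isOpen))

theorem IsSolution.not_lt_of_mem_intersectionPoints (h₁ : IsSolution I₁ y₁)
    (h₂ : IsSolution I₂ y₂) (hne : ¬ (I₁ = I₂ ∧ EqOn y₁ y₂ I₁))
    (hP : P ∈ intersectionPoints I₁ y₁ I₂ y₂) (hQ : Q ∈ intersectionPoints I₁ y₁ I₂ y₂)
    (hR : R ∈ intersectionPoints I₁ y₁ I₂ y₂) (hR0 : R.1 ≤ 0) (hPQ : P.1 < Q.1) :
    ¬ Q.1 < R.1 := by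
  intro hQR
  have hPR := hPQ.trans hQR
  have hs₁ : Ioo P.1 R.1 ⊆ I₁ := Ioo_subset_of_mem_closure h₁.ordConnected
    (fst_mem_closure_of_mem_extendedGraph h₁.isConnected.nonempty hP.1)
    (fst_mem_closure_of_mem_extendedGraph h₁.isConnected.nonempty hR.1)
  have hs₂ : Ioo P.1 R.1 ⊆ I₂ := Ioo_subset_of_mem_closure h₂.ordConnected
    (fst_mem_closure_of_mem_extendedGraph h₂.isConnected.nonempty hP.2)
    (fst_mem_closure_of_mem_extendedGraph h₂.isConnected.nonempty hR.2)
  have hQ₁ : Q.1 ∈ I₁ := hs₁ ⟨hPQ, hQR⟩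
  rcases mem_intersectionPoints_cases hQ with ⟨-, hQ₂, heq, -⟩ | ⟨he₁, -⟩
  · exact (h₁.solves.systemOn.mono hs₁).not_tendsto_sub_nhdsGT_of_tendsto_sub_nhdsLT hPQ hQR hR0
      (h₂.solves.systemOn.mono hs₂) heq (h₁.deriv_ne h₂ hne hQ₁ hQ₂ heq)
      (h₁.tendsto_sub_nhdsLT h₂ hR hPR hs₁ hs₂) (h₁.tendsto_sub_nhdsGT h₂ hP hPR hs₁ hs₂)
  · exact he₁.notMem h₁.isOpen hQ₁

end Intersection

end PainleveI

theorem theorem6p1 (I₁ I₂ : Set ℝ) (y₁ y₂ : ℝ → ℝ)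
    (h₁ : PainleveI.IsSolution I₁ y₁) (h₂ : PainleveI.IsSolution I₂ y₂)
    (hne : ¬ (I₁ = I₂ ∧ Set.EqOn y₁ y₂ I₁)) :
    {P ∈ PainleveI.intersectionPoints I₁ y₁ I₂ y₂ | P.1 ≤ 0}.encard ≤ 2 := by
  have hinj := (PainleveI.injOn_fst_intersectionPoints h₁.isOpen).mono
    (Set.sep_subset (PainleveI.intersectionPoints I₁ y₁ I₂ y₂) fun P => P.1 ≤ 0)
  rw [← hinj.encard_image]
  apply PainleveI.encard_le_two_of_forall_not_lt
  rintro _ ⟨P, ⟨hP, -⟩, rfl⟩ _ ⟨Q, ⟨hQ, -⟩, rfl⟩ _ ⟨R, ⟨hR, hR0⟩, rfl⟩ hPQ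
  exact h₁.not_lt_of_mem_intersectionPoints h₂ hne hP hQ hR hR0 hPQ
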